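/- Let $(\varphi_e)_{e\in\omega}$ be a standard enumeration of the partial computable functions on $\omega$. For $p,q\subseteq\omega$ let $p\to q$ be the set of all $e$ such that $\varphi_e(a)$ is defined and lies in $q$ for every $a\in p$. A Lawvere–Tierney (LT) topology in the effective topos is a map $j\colon\mathcal P(\omega)\to\mathcal P(\omega)$ for which the formulas $(p\to q)\to(j(p)\to j(q))$, $p\to j(p)$ and $j(j(p))\leftrightarrow j(p)$ are valid, meaning that each implication has a realiser $e$ that works for all $p,q\subseteq\omega$ at once. For maps $f,g\colon\mathcal P(\omega)\to\mathcal P(\omega)$ write $f\leq_{\mathrm{LT}}g$ if there is one $e\in\omega$ with $e\in\big(f(p)\to g(p)\big)$ for all $p\subseteq\omega$; on LT topologies this is the $\leq_{\mathrm{LT}}$-order. For a family $\mathcal A\subseteq\mathcal P(\omega)$ put $G_{\mathcal A}(p)=\bigcup_{A\in\mathcal A}(A\to p)$. The basic topology $j_{\mathcal A}$ is the $\leq_{\mathrm{LT}}$-least LT topology $j$ with $G_{\mathcal A}\leq_{\mathrm{LT}}j$; explicitly, $j_{\mathcal A}(p)$ is the intersection of all $q\subseteq\omega$ such that $\langle 0,a\rangle\in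 q$ for all $a\in p$ and $\langle 1,b\rangle\in q$ for all $b\in G_{\mathcal A}(q)$. For lower sets $\mathcal H,\mathcal I\subseteq\mathcal P(\omega)$, with duals $\mathcal H^*=\{A\subseteq\omega:\omega\setminus A\in\mathcal H\}$ and $\mathcal I^*$ likewise, write $\mathcal H\leq_{\mathrm{LT}}\mathcal I$ if $j_{\mathcal H^*}\leq_{\mathrm{LT}}j_{\mathcal I^*}$, and $\mathcal H<_{\mathrm{LT}}\mathcal I$ if moreover $\mathcal I\not\leq_{\mathrm{LT}}\mathcal H$. Let $\mathrm{Fin}$ be the set of finite subsets of $\omega$. Let $\mathrm{Sum}_{1/n}$ be the set of all $A\subseteq\omega$ with $\sum_{n\in A,\,n>0}\frac1n<\infty$. Partition $\omega$ into consecutive intervals $I_0,I_1,I_2,\dots$ with $|I_a|=a$. For $m\in\omega$ let $\mathrm{ED}_{\mathrm{fin}}[m]$ be the set of all $A\subseteq\omega$ with $|A\cap I_n|\leq m$ for all but finitely many $n$, and let $\mathrm{ED}_{\mathrm{fin}}=\bigcup_{m\in\omega}\mathrm{ED}_{\mathrm{fin}}[m]$. Then there is an infinite strictly ascending chain $$\mathrm{Fin}<_{\mathrm{LT}}\mathrm{ED}_{\mathrm{fin}}[1]<_{\mathrm{LT}}\cdots<_{\mathrm{LT}}\mathrm{ED}_{\mathrm{fin}}[m]<_{\mathrm{LT}}\mathrm{ED}_{\mathrm{fin}}[m+1]<_{\mathrm{LT}}\cdots<_{\mathrm{LT}}\mathrm{ED}_{\mathrm{fin}}<_{\mathrm{LT}}\mathrm{Sum}_{1/n};$$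 that is, $\mathrm{Fin}<_{\mathrm{LT}}\mathrm{ED}_{\mathrm{fin}}[1]$; for every $m\geq1$, $\mathrm{ED}_{\mathrm{fin}}[m]<_{\mathrm{LT}}\mathrm{ED}_{\mathrm{fin}}[m+1]$ and $\mathrm{ED}_{\mathrm{fin}}[m]<_{\mathrm{LT}}\mathrm{ED}_{\mathrm{fin}}$; and $\mathrm{ED}_{\mathrm{fin}}<_{\mathrm{LT}}\mathrm{Sum}_{1/n}$. In particular the basic topologies of the duals of the $\mathrm{ED}_{\mathrm{fin}}[m]$, $m\geq1$, are pairwise $\leq_{\mathrm{LT}}$-inequivalent, so they realise infinitely many distinct LT degrees. -/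

import Mathlib

namespace EffTop

open Nat.Partrec (Code)

/-! ### Realisability -/

/-- The `e`-th partial computable function on `ω`. -/
def phi (e : ℕ) : ℕ →. ℕ := Code.eval (Denumerable.ofNat Code e)

/-- The realisability implication `p → q`: the set of all `e` such that for every `a ∈ p`,
`φ_e(a)` is defined and lies in `q`. -/
def rImp (p q : Set ℕ) : Set ℕ := {e | ∀ a ∈ p, ∃ b ∈ phi e a, b ∈ q}

/-- `∀ p. f(p) → g(p)` is valid: one number realises all these implications at once. -/
def UnifLE (f g : Set ℕ → Set ℕ) : Prop := ∃ e : ℕ, ∀ p : Set ℕ, e ∈ rImp (f p) (g p)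

/-- A Lawvere–Tierney topology in the effective topos: an endomorphism of the power set of `ω`
which validates, in the sense of realisability, `(p → q) → (j p → j q)`, `p → j p` and
`j (j p) ↔ j p`, uniformly in `p` and `q`. -/
structure LTTopology where
  toFun : Set ℕ → Set ℕ
  mono : ∃ e : ℕ, ∀ p q : Set ℕ, e ∈ rImp (rImp p q) (rImp (toFun p) (toFun q))
  unit : UnifLE id toFun
  idem : UnifLE (toFun ∘ toFun) toFun ∧ UnifLE toFun (toFun ∘ toFun)

theorem phi_encode (c : Code) : phi (Encodable.encode c) = c.eval := by
  simp [phi]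

theorem UnifLE.refl (f : Set ℕ → Set ℕ) : UnifLE f f :=
  ⟨Encodable.encode Code.id, fun p a ha => ⟨a, by simp [phi_encode], ha⟩⟩

theorem UnifLE.trans {f g h : Set ℕ → Set ℕ} (hfg : UnifLE f g) (hgh : UnifLE g h) :
    UnifLE f h := by
  obtain ⟨d, hd⟩ := hfg
  obtain ⟨e, he⟩ := hgh
  refine ⟨Encodable.encode (Code.comp (Denumerable.ofNat Code e) (Denumerable.ofNat Code d)),
    fun p a ha => ?_⟩
  obtain ⟨b, hb, hb'⟩ := hd p a ha
  obtain ⟨c, hc, hc'⟩ := he p b hb'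
  refine ⟨c, ?_, hc'⟩
  rw [phi_encode]
  exact Part.mem_bind_iff.2 ⟨b, hb, hc⟩

/-- The Lawvere–Tierney order: `j ≤ k` iff `∀ p. j(p) → k(p)` is valid. The strict order `j < k`
is `j ≤ k ∧ ¬ k ≤ j`. -/
instance : Preorder LTTopology where
  le j k := UnifLE j.toFun k.toFun
  le_refl j := UnifLE.refl j.toFun
  le_trans _ _ _ h₁ h₂ := UnifLE.trans h₁ h₂

/-! ### Basic topologies -/

/-- The monotone endomorphism `G_𝒜(p) = ⋃_{A ∈ 𝒜} (A → p)` of a family `𝒜` of subsets of `ω`. -/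
def G (𝒜 : Set (Set ℕ)) (p : Set ℕ) : Set ℕ := ⋃ A ∈ 𝒜, rImp A p

/-- The reflector: `L(f)(p)` is the intersection of all `q` with `{0} ∧ p ⊆ q` and
`{1} ∧ f(q) ⊆ q`, where `x ∧ y` is the set of codes of pairs. -/
def L (f : Set ℕ → Set ℕ) (p : Set ℕ) : Set ℕ :=
  ⋂₀ {q | (∀ a ∈ p, Nat.pair 0 a ∈ q) ∧ (∀ b ∈ f q, Nat.pair 1 b ∈ q)}

theorem G_mono (𝒜 : Set (Set ℕ)) {p q : Set ℕ} (h : p ⊆ q) : G 𝒜 p ⊆ G 𝒜 q := by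
  intro e he
  simp only [G, Set.mem_iUnion] at he ⊢
  obtain ⟨A, hA, he⟩ := he
  exact ⟨A, hA, fun a ha => (he a ha).imp fun b hb => ⟨hb.1, h hb.2⟩⟩

theorem L_left (f : Set ℕ → Set ℕ) {p : Set ℕ} {a : ℕ} (ha : a ∈ p) : Nat.pair 0 a ∈ L f p :=
  fun _ hq => hq.1 a ha

theorem L_right (𝒜 : Set (Set ℕ)) {p : Set ℕ} {b : ℕ} (hb : b ∈ G 𝒜 (L (G 𝒜) p)) :
    Nat.pair 1 b ∈ L (G 𝒜) p := by
  intro q hq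
  have hsub : L (G 𝒜) p ⊆ q := fun x hx => Set.mem_sInter.1 hx q hq
  exact hq.2 b (G_mono 𝒜 hsub hb)

/-- Recursion over the elements of `L (G 𝒜) p`, as a partial computable function. -/
theorem exists_fold {h : ℕ → ℕ →. ℕ} {v : ℕ →. ℕ} (hh : Partrec₂ h) (hv : Partrec v) :
    ∃ d : Code, (∀ c a, d.eval (Nat.pair c (Nat.pair 0 a)) = h c a) ∧
      ∀ c b, d.eval (Nat.pair c (Nat.pair 1 b)) =
        v (Encodable.encode (Code.comp (Code.curry d c) (Denumerable.ofNat Code b))) := by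
  let F : Code → ℕ →. ℕ := fun d n =>
    cond (decide (n.unpair.2.unpair.1 = 0)) (h n.unpair.1 n.unpair.2.unpair.2)
      (v (Encodable.encode (Code.comp (Code.curry d n.unpair.1)
        (Denumerable.ofNat Code n.unpair.2.unpair.2))))
  have u1 : Computable fun x : Code × ℕ => x.2.unpair.1 :=
    (Primrec.fst.comp (Primrec.unpair.comp Primrec.snd)).to_comp
  have u2 : Computable fun x : Code × ℕ => x.2.unpair.2.unpair.2 :=
    (Primrec.snd.comp (Primrec.unpair.comp
      (Primrec.snd.comp (Primrec.unpair.comp Primrec.snd)))).to_comp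
  have u3 : Primrec fun x : Code × ℕ => x.2.unpair.2.unpair.1 :=
    Primrec.fst.comp (Primrec.unpair.comp
      (Primrec.snd.comp (Primrec.unpair.comp Primrec.snd)))
  have hF : Partrec₂ F := by
    refine Partrec.cond ?_ (hh.comp u1 u2) (hv.comp ?_)
    · exact (Primrec.eq.comp u3 (Primrec.const 0)).decide.to_comp
    · refine Computable.encode.comp ?_
      refine (Code.primrec₂_comp.to_comp).comp
        ((Code.primrec₂_curry.to_comp).comp Computable.fst u1) ?_
      exact (Computable.ofNat Code).comp u2
  obtain ⟨d, hd⟩ := Code.fixed_point₂ hF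
  refine ⟨d, fun c a => ?_, fun c b => ?_⟩
  · rw [hd]; simp [F]
  · rw [hd]; simp [F]

/-- If `h(c, -)` maps `p` to `k` and `v` maps `G 𝒜 k` to `k`, then the recursion maps
`L (G 𝒜) p` to `k`. -/
theorem fold_spec (𝒜 : Set (Set ℕ)) {h : ℕ → ℕ →. ℕ} {v : ℕ →. ℕ} {d : Code}
    (h0 : ∀ c a, d.eval (Nat.pair c (Nat.pair 0 a)) = h c a)
    (h1 : ∀ c b, d.eval (Nat.pair c (Nat.pair 1 b)) =
        v (Encodable.encode (Code.comp (Code.curry d c) (Denumerable.ofNat Code b))))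
    {c : ℕ} {p k : Set ℕ} (hp : ∀ a ∈ p, ∃ b ∈ h c a, b ∈ k)
    (hk : ∀ a ∈ G 𝒜 k, ∃ b ∈ v a, b ∈ k) :
    ∀ n ∈ L (G 𝒜) p, ∃ b ∈ d.eval (Nat.pair c n), b ∈ k := by
  intro n hn
  refine hn {n | ∃ b ∈ d.eval (Nat.pair c n), b ∈ k} ⟨?_, ?_⟩
  · intro a ha
    simpa [h0] using hp a ha
  · intro b hb
    change ∃ z ∈ d.eval (Nat.pair c (Nat.pair 1 b)), z ∈ k
    rw [h1]
    apply hk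
    simp only [G, Set.mem_iUnion] at hb ⊢
    obtain ⟨A, hA, hb⟩ := hb
    refine ⟨A, hA, fun x hx => ?_⟩
    obtain ⟨y, hy, z, hz, hzk⟩ := hb x hx
    refine ⟨z, ?_, hzk⟩
    rw [phi_encode]
    refine Part.mem_bind_iff.2 ⟨y, hy, ?_⟩
    rw [Code.eval_curry]
    exact hz

theorem partrec_pair (i : ℕ) : Partrec fun b : ℕ => Part.some (Nat.pair i b) :=
  (Primrec₂.natPair.comp (Primrec.const i) Primrec.id).to_comp.partrec

/-- The basic topology `j_𝒜 = L(G_𝒜)` of a family `𝒜` of subsets of `ω`. -/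
def basicTopology (𝒜 : Set (Set ℕ)) : LTTopology where
  toFun := L (G 𝒜)
  mono := by
    have hh : Partrec₂ fun c a : ℕ => (phi c a).map fun b => Nat.pair 0 b := by
      refine Partrec.map (Code.eval_part.comp
        ((Computable.ofNat Code).comp Computable.fst) Computable.snd) ?_
      exact (Primrec₂.natPair.comp (Primrec.const 0) Primrec.snd).to_comp
    obtain ⟨d, h0, h1⟩ := exists_fold hh (partrec_pair 1)
    obtain ⟨e, he⟩ := Code.exists_code.1 (Partrec.nat_iff.1
      ((Computable.encode.comp ((Code.primrec₂_curry.to_comp).comp (Computable.const d)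
        Computable.id)).partrec : Partrec fun c : ℕ =>
          (Part.some (Encodable.encode (Code.curry d c)) : Part ℕ)))
    refine ⟨Encodable.encode e, fun p q c hc =>
      ⟨Encodable.encode (Code.curry d c), by simp [phi_encode, he], fun n hn => ?_⟩⟩
    simp only [phi_encode, Code.eval_curry]
    refine fold_spec 𝒜 (v := fun b => Part.some (Nat.pair 1 b)) h0 h1 (fun a ha => ?_) (fun a ha => ?_) n hn
    · obtain ⟨b, hb, hbq⟩ := hc a ha
      exact ⟨Nat.pair 0 b, Part.mem_map _ hb, L_left _ hbq⟩
    · exact ⟨_, Part.mem_some _, L_right 𝒜 ha⟩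
  unit := by
    obtain ⟨e, he⟩ := Code.exists_code.1 (Partrec.nat_iff.1 (partrec_pair 0))
    exact ⟨Encodable.encode e, fun p a ha =>
      ⟨Nat.pair 0 a, by simp [phi_encode, he], L_left _ ha⟩⟩
  idem := by
    constructor
    · have hh : Partrec₂ fun _ a : ℕ => Part.some a := Computable.snd.partrec
      obtain ⟨d, h0, h1⟩ := exists_fold hh (partrec_pair 1)
      refine ⟨Encodable.encode (Code.curry d 0), fun p n hn => ?_⟩
      simp only [phi_encode, Code.eval_curry]
      refine fold_spec 𝒜 (v := fun b => Part.some (Nat.pair 1 b)) h0 h1 (fun a ha => ?_) (fun a ha => ?_) n hn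
      · exact ⟨_, Part.mem_some _, ha⟩
      · exact ⟨_, Part.mem_some _, L_right 𝒜 ha⟩
    · obtain ⟨e, he⟩ := Code.exists_code.1 (Partrec.nat_iff.1 (partrec_pair 0))
      exact ⟨Encodable.encode e, fun p a ha =>
        ⟨Nat.pair 0 a, by simp [phi_encode, he], L_left _ ha⟩⟩

/-- `G_𝒜` lies below the basic topology `j_𝒜`. -/
theorem G_le_basicTopology (𝒜 : Set (Set ℕ)) : UnifLE (G 𝒜) (basicTopology 𝒜).toFun := by
  obtain ⟨d, hd⟩ := (basicTopology 𝒜).unit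
  obtain ⟨e, he⟩ := Code.exists_code.1 (Partrec.nat_iff.1
    ((Primrec₂.natPair.comp (Primrec.const 1) (Primrec.encode.comp
      (Code.primrec₂_comp.comp (Primrec.const (Denumerable.ofNat Code d))
        (Primrec.ofNat Code)))).to_comp.partrec : Partrec fun b : ℕ =>
          (Part.some (Nat.pair 1 (Encodable.encode (Code.comp (Denumerable.ofNat Code d)
            (Denumerable.ofNat Code b)))) : Part ℕ)))
  refine ⟨Encodable.encode e, fun p b hb => ⟨_, by rw [phi_encode, he]; exact Part.mem_some _, ?_⟩⟩
  apply L_right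
  simp only [G, Set.mem_iUnion] at hb ⊢
  obtain ⟨A, hA, hb⟩ := hb
  refine ⟨A, hA, fun x hx => ?_⟩
  obtain ⟨y, hy, hyp⟩ := hb x hx
  obtain ⟨z, hz, hzp⟩ := hd p y hyp
  refine ⟨z, ?_, hzp⟩
  rw [phi_encode]
  exact Part.mem_bind_iff.2 ⟨y, hy, hz⟩

/-- `j_𝒜` is the least Lawvere–Tierney topology above `G_𝒜`. -/
theorem basicTopology_le (𝒜 : Set (Set ℕ)) (k : LTTopology) (hk : UnifLE (G 𝒜) k.toFun) :
    basicTopology 𝒜 ≤ k := by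
  have hkk : UnifLE (G 𝒜 ∘ k.toFun) k.toFun := by
    refine UnifLE.trans (g := k.toFun ∘ k.toFun) ?_ k.idem.1
    obtain ⟨e, he⟩ := hk
    exact ⟨e, fun p => he (k.toFun p)⟩
  obtain ⟨v, hv⟩ := hkk
  obtain ⟨u, hu⟩ := k.unit
  have hpart : ∀ e, Partrec (phi e) := fun e =>
    Partrec.nat_iff.2 (Code.exists_code.2 ⟨Denumerable.ofNat Code e, rfl⟩)
  have hh : Partrec₂ fun _ a : ℕ => phi u a := (hpart u).comp Computable.snd
  obtain ⟨d, h0, h1⟩ := exists_fold hh (hpart v)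
  refine ⟨Encodable.encode (Code.curry d 0), fun p n hn => ?_⟩
  simp only [phi_encode, Code.eval_curry]
  exact fold_spec 𝒜 h0 h1 (hu p) (hv p) n hn

/-! ### Lower sets of subsets of `ω` -/

/-- The dual `𝓗^* = {A | ω \ A ∈ 𝓗}`. -/
def dual (𝓗 : Set (Set ℕ)) : Set (Set ℕ) := {A | Aᶜ ∈ 𝓗}

/-- The basic topology attached to a lower set `𝓗`, namely that of its dual upper set. Lower sets
are compared in the Lawvere–Tierney order through these topologies. -/
def lowerTopology (𝓗 : Set (Set ℕ)) : LTTopology := basicTopology (dual 𝓗)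

/-- The ideal of finite sets. -/
def FinIdeal : Set (Set ℕ) := {A | A.Finite}

/-- The summable ideal of `f`. -/
def SumIdeal (f : ℕ → ℝ) : Set (Set ℕ) := {A | Summable fun n : A => f n}

/-- The summable ideal of the function `1/n` (with value `0` at `n = 0`). -/
def SumInv : Set (Set ℕ) := SumIdeal fun n => if n = 0 then 0 else 1 / (n : ℝ)

/-- The `a`-th interval in the partition of `ω` into consecutive intervals `I_0, I_1, I_2, …`
in which `I_a` has length `a`; it starts at `0 + 1 + ⋯ + (a - 1)`. -/
def interval (a : ℕ) : Set ℕ :=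
  Set.Ico (∑ i ∈ Finset.range a, i) (∑ i ∈ Finset.range (a + 1), i)

/-- `ED_fin[m]`: all `A` with `|A ∩ I_n| ≤ m` for all but finitely many `n`. -/
def EDfinLe (m : ℕ) : Set (Set ℕ) := {A | {n | ¬ (A ∩ interval n).encard ≤ m}.Finite}

/-- `ED_fin = ⋃_m ED_fin[m]`. -/
def EDfin : Set (Set ℕ) := ⋃ m, EDfinLe m

end EffTop

namespace EffTop

open Nat.Partrec (Code)

/-! ### Comparing lower sets -/

/-! The reductions `≤` come from inclusions of lower sets; `EDfin ⊆ SumInv` holds because `I_n`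
begins at about `n²/2`, so `m` points in it weigh `O(m/n²)`.

For strictness, regard members of `L (G (dual 𝓗)) p` as well-founded trees: a leaf carries an
element of `p`, and a node branches over some set in `dual 𝓗`. A reduction of `𝓘` to `𝓗`, applied to
the identity code, gives one number `n` lying in `L (G (dual 𝓗)) Cᶜ` for every `C ∈ 𝓘`
(`exists_mem_L_compl_of_le`). `Diagonalizes.not_le` refutes this by one choice of `C` handling the
labellings of all nodes at once; computability enters only through there being countably many codes.

It remains to diagonalise. Pieces in `ED_fin[m]` with finitely many forbidden labels cover boundedly
many points of each long interval, so any number of points with large labels can be found there.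
Selecting `m + 1` such labels at a time, in disjoint blocks of intervals, keeps `C` in
`ED_fin[m+1]`; selecting ever more labels, rapidly growing, keeps `C` summable. Since `Fin` is
`ED_fin[0]`, the first step of the chain is not special. -/

theorem lowerTopology_mono {𝓗 𝓘 : Set (Set ℕ)} (h : 𝓗 ⊆ 𝓘) :
    lowerTopology 𝓗 ≤ lowerTopology 𝓘 := by
  refine basicTopology_le _ _ (UnifLE.trans ?_ (G_le_basicTopology (dual 𝓘)))
  refine ⟨Encodable.encode Code.id, fun p a ha => ⟨a, by simp [phi_encode], ?_⟩⟩
  simp only [G, Set.mem_iUnion] at ha ⊢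
  obtain ⟨A, hA, ha⟩ := ha
  exact ⟨A, h hA, ha⟩

/-- Inversion at leaves, by induction on `L`: the tags 0 and 1 keep leaves and nodes apart. -/
theorem of_pair_zero_mem_L {𝒜 : Set (Set ℕ)} {p : Set ℕ} {a : ℕ}
    (h : Nat.pair 0 a ∈ L (G 𝒜) p) : a ∈ p := by
  have := h {n | ∀ a, n = Nat.pair 0 a → a ∈ p} ⟨fun a ha b hb => ?_, fun b _ a hab => ?_⟩
  · exact this a rfl
  · rw [Nat.pair_eq_pair] at hb
    exact hb.2 ▸ ha
  · rw [Nat.pair_eq_pair] at hab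
    omega

theorem of_pair_one_mem_L {𝒜 : Set (Set ℕ)} {p : Set ℕ} {b : ℕ}
    (h : Nat.pair 1 b ∈ L (G 𝒜) p) : b ∈ G 𝒜 (L (G 𝒜) p) := by
  -- Membership in `L` is carried along in the induction so that `G_mono` applies at nodes.
  have := h {n | n ∈ L (G 𝒜) p ∧ ∀ b, n = Nat.pair 1 b → b ∈ G 𝒜 (L (G 𝒜) p)}
    ⟨fun a ha => ⟨L_left _ ha, fun b hb => ?_⟩, fun b hb => ?_⟩
  · exact this.2 b rfl
  · rw [Nat.pair_eq_pair] at hb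
    omega
  · have hb' : b ∈ G 𝒜 (L (G 𝒜) p) := G_mono 𝒜 (fun _ hx => hx.1) hb
    refine ⟨L_right 𝒜 hb', fun c hc => ?_⟩
    rw [Nat.pair_eq_pair] at hc
    exact hc.2 ▸ hb'

/-- The identity code lies in `G (dual 𝓘) Cᶜ` for every `C ∈ 𝓘`, and a uniform realiser sends it to
the same number each time. -/
theorem exists_mem_L_compl_of_le {𝓗 𝓘 : Set (Set ℕ)}
    (h : lowerTopology 𝓘 ≤ lowerTopology 𝓗) :
    ∃ n, ∀ C ∈ 𝓘, n ∈ L (G (dual 𝓗)) Cᶜ := by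
  obtain ⟨e, he⟩ := UnifLE.trans (G_le_basicTopology (dual 𝓘)) h
  have key : ∀ C ∈ 𝓘, ∃ n ∈ phi e (Encodable.encode Code.id), n ∈ L (G (dual 𝓗)) Cᶜ := by
    intro C hC
    refine he Cᶜ _ ?_
    simp only [G, Set.mem_iUnion]
    exact ⟨Cᶜ, by simpa [dual] using hC, fun a ha => ⟨a, by simp [phi_encode], ha⟩⟩
  by_cases hne : ∃ C, C ∈ 𝓘
  · obtain ⟨C, hC⟩ := hne
    obtain ⟨n, hn, -⟩ := key C hC
    refine ⟨n, fun D hD => ?_⟩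
    obtain ⟨k, hk, hkD⟩ := key D hD
    exact Part.mem_unique hk hn ▸ hkD
  · exact ⟨0, fun C hC => (hne ⟨C, hC⟩).elim⟩

/-- `𝓘` diagonalises against `𝓗`: given countably many partitions of `ω` into pieces from `𝓗`,
each with one exceptional piece and the others labelled by numbers, there is a single set of labels
in `𝓘` such that, in each partition, the pieces with these labels have a union outside `𝓗`. -/
def Diagonalizes (𝓘 𝓗 : Set (Set ℕ)) : Prop :=
  ∀ v : ℕ → ℕ → Option ℕ, (∀ i o, {x | v i x = o} ∈ 𝓗) →
    ∃ C ∈ 𝓘, ∀ i, {x | ∃ c ∈ C, v i x = some c} ∉ 𝓗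

/-- Say that `n` is forced to `v` if `n ∉ L (G (dual 𝓗)) {v}ᶜ`. A number realising the reduction
would be forced to no `v`. If `C` diagonalises against the labellings of the successors of such
numbers, then every member of `L (G (dual 𝓗)) Cᶜ` is forced to some `v`, a contradiction. -/
theorem Diagonalizes.not_le {𝓗 𝓘 : Set (Set ℕ)} (hD : Diagonalizes 𝓘 𝓗)
    (hlow : IsLowerSet 𝓗) (hsing : ∀ v, {v} ∈ 𝓘) :
    ¬ lowerTopology 𝓘 ≤ lowerTopology 𝓗 := by
  classical
  intro hle
  obtain ⟨n, hn⟩ := exists_mem_L_compl_of_le hle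
  have hnv : ∀ v, n ∈ L (G (dual 𝓗)) {v}ᶜ := fun v => hn _ (hsing v)
  -- The label of `x` is some `v` to which the successor `φ_b(x)` is forced, and `none` if there is
  -- no such `v`.
  let w : ℕ → ℕ → Option ℕ := fun b x =>
    if h : ∃ v, ∃ y ∈ phi b x, y ∉ L (G (dual 𝓗)) {v}ᶜ then some h.choose else none
  have hw : ∀ b x v, w b x = some v → ∃ y ∈ phi b x, y ∉ L (G (dual 𝓗)) {v}ᶜ := by
    intro b x v hv
    by_cases h : ∃ v, ∃ y ∈ phi b x, y ∉ L (G (dual 𝓗)) {v}ᶜ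
    · simp only [w, dif_pos h, Option.some.injEq] at hv
      exact hv ▸ h.choose_spec
    · simp [w, dif_neg h] at hv
  have hw' : ∀ b x, w b x = none → ¬ ∃ v, ∃ y ∈ phi b x, y ∉ L (G (dual 𝓗)) {v}ᶜ := by
    intro b x hv h
    simp [w, dif_pos h] at hv
  have hdual : ∀ {A B : Set ℕ}, B ∈ dual 𝓗 → (∀ x ∈ A, x ∉ B) → A ∈ 𝓗 := fun hB h => hlow h hB
  let S : Set ℕ := {b | ∀ o, {x | w b x = o} ∈ 𝓗}
  have hC : ∃ C ∈ 𝓘, ∀ b ∈ S, {x | ∃ c ∈ C, w b x = some c} ∉ 𝓗 := by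
    by_cases hS : ∃ b, b ∈ S
    · obtain ⟨b₀, hb₀⟩ := hS
      -- Codes outside `S` get the labelling of `b₀`, since every labelling must have its pieces in
      -- `𝓗`.
      obtain ⟨C, hC, h⟩ := hD (fun b => if b ∈ S then w b else w b₀) (fun i o => by
        by_cases hi : i ∈ S
        · simpa [hi] using hi o
        · simpa [hi] using hb₀ o)
      exact ⟨C, hC, fun b hb => by simpa [hb] using h b⟩
    · exact ⟨{0}, hsing 0, fun b hb => (hS ⟨b, hb⟩).elim⟩
  obtain ⟨C, hC, hCS⟩ := hC
  -- Induction over `L (G (dual 𝓗)) Cᶜ`: each member is forced to some `v`, and to none in `C`.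
  refine absurd (hn C hC {n | (∃ v, n ∉ L (G (dual 𝓗)) {v}ᶜ) ∧
    ∀ v ∈ C, n ∈ L (G (dual 𝓗)) {v}ᶜ} ⟨fun a ha => ⟨⟨a, fun h => ?_⟩, fun v hv => ?_⟩,
      fun b hb => ?_⟩) fun h => h.1.elim fun v hv => hv (hnv v)
  · exact of_pair_zero_mem_L h rfl
  · exact L_left _ fun hav => ha (hav ▸ hv)
  · simp only [G, Set.mem_iUnion] at hb
    obtain ⟨B, hB, hb⟩ := hb
    refine ⟨?_, fun v hv => L_right _ ?_⟩
    -- If the node is forced to no `v`, every piece of its labelling misses a set in `dual 𝓗`, so `b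
    -- ∈ S`. The pieces labelled in `C` together miss `B`, against the choice of `C`.
    · by_contra! hall
      have hfib : ∀ v, {x | w b x = some v} ∈ 𝓗 := by
        intro v
        have := of_pair_one_mem_L (hall v)
        simp only [G, Set.mem_iUnion] at this
        obtain ⟨A, hA, hbA⟩ := this
        refine hdual hA fun x hx hxA => ?_
        obtain ⟨y, hy, hyv⟩ := hw b x v hx
        obtain ⟨z, hz, hzL⟩ := hbA x hxA
        exact hyv (Part.mem_unique hz hy ▸ hzL)
      have hnone : {x | w b x = none} ∈ 𝓗 := by
        refine hdual hB fun x hx hxB => hw' b x hx ?_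
        obtain ⟨y, hy, ⟨v, hv⟩, -⟩ := hb x hxB
        exact ⟨v, y, hy, hv⟩
      refine hCS b (fun o => ?_) (hdual hB fun x hx hxB => ?_)
      · cases o with
        | none => exact hnone
        | some v => exact hfib v
      · obtain ⟨c, hc, hxc⟩ := hx
        obtain ⟨y, hy, hyc⟩ := hw b x c hxc
        obtain ⟨z, hz, -, hzL⟩ := hb x hxB
        exact hyc (Part.mem_unique hz hy ▸ hzL c hc)
    · simp only [G, Set.mem_iUnion]
      refine ⟨B, hB, fun x hx => ?_⟩
      obtain ⟨y, hy, -, hyL⟩ := hb x hx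
      exact ⟨y, hy, hyL v hv⟩

/-! ### The intervals -/

/-- The left end of the `n`-th interval. -/
def start (n : ℕ) : ℕ := ∑ i ∈ Finset.range n, i

theorem start_succ (n : ℕ) : start (n + 1) = start n + n := Finset.sum_range_succ _ _

theorem start_mono : Monotone start :=
  monotone_nat_of_le_succ fun n => by rw [start_succ]; omega

theorem le_start_succ (n : ℕ) : n ≤ start (n + 1) := by rw [start_succ]; omega

theorem mem_interval {n x : ℕ} : x ∈ interval n ↔ start n ≤ x ∧ x < start (n + 1) := Iff.rfl

/-- The `n`-th interval as a finite set. -/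
def intervalFinset (n : ℕ) : Finset ℕ := Finset.Ico (start n) (start (n + 1))

theorem coe_intervalFinset (n : ℕ) : (intervalFinset n : Set ℕ) = interval n := by
  simp [intervalFinset, interval, start]

theorem card_intervalFinset (n : ℕ) : (intervalFinset n).card = n := by
  simp [intervalFinset, start_succ]

theorem exists_mem_interval (x : ℕ) : ∃ n, x ∈ interval n := by
  have h : ∃ n, x < start (n + 1) := ⟨x + 1, by rw [start_succ]; have := le_start_succ x; omega⟩
  classical
  refine ⟨Nat.find h, ?_, Nat.find_spec h⟩
  by_contra! hlt
  change x < start (Nat.find h) at hlt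
  cases hk : Nat.find h with
  | zero => rw [hk] at hlt; simp [start] at hlt
  | succ k =>
    rw [hk] at hlt
    have := Nat.find_min h (m := k) (by omega)
    exact this hlt

theorem mem_EDfinLe {m : ℕ} {A : Set ℕ} :
    A ∈ EDfinLe m ↔ ∀ᶠ n in Filter.atTop, (A ∩ interval n).encard ≤ m := by
  rw [← Nat.cofinite_eq_atTop, Filter.eventually_cofinite]
  rfl

theorem EDfinLe_mono : Monotone EDfinLe := by
  intro m k hmk A hA
  rw [mem_EDfinLe] at hA ⊢
  filter_upwards [hA] with n hn
  exact hn.trans (by exact_mod_cast hmk)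

theorem isLowerSet_EDfinLe (m : ℕ) : IsLowerSet (EDfinLe m) := by
  intro A B hBA hA
  rw [mem_EDfinLe] at hA ⊢
  filter_upwards [hA] with n hn
  exact (Set.encard_le_encard (Set.inter_subset_inter_left _ hBA)).trans hn

theorem isLowerSet_EDfin : IsLowerSet EDfin :=
  isLowerSet_iUnion fun m => isLowerSet_EDfinLe m

theorem EDfinLe_zero : EDfinLe 0 = FinIdeal := by
  ext A
  rw [mem_EDfinLe]
  constructor
  · intro h
    obtain ⟨N, hN⟩ := Filter.eventually_atTop.1 h
    refine (Set.finite_lt_nat (start N)).subset fun x hx => ?_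
    obtain ⟨n, hn⟩ := exists_mem_interval x
    have hnN : n < N := by
      by_contra! hle
      have := hN n hle
      simp only [Nat.cast_zero, nonpos_iff_eq_zero, Set.encard_eq_zero] at this
      exact this.subset ⟨hx, hn⟩
    exact hn.2.trans_le (start_mono hnN)
  · intro h
    obtain ⟨N, hN⟩ := Set.Finite.bddAbove h
    refine Filter.eventually_atTop.2 ⟨N + 2, fun n hn => ?_⟩
    rw [Nat.cast_zero, nonpos_iff_eq_zero, Set.encard_eq_zero]
    refine Set.eq_empty_of_forall_notMem fun x hx => ?_
    have h1 := hN hx.1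
    have h2 : start (N + 1 + 1) ≤ start n := start_mono hn
    have h3 := (mem_interval.1 hx.2).1
    have h4 := le_start_succ (N + 1)
    omega

theorem singleton_mem_EDfinLe {m : ℕ} (hm : 1 ≤ m) (v : ℕ) : {v} ∈ EDfinLe m := by
  rw [mem_EDfinLe]
  refine Filter.Eventually.of_forall fun n => ?_
  refine (Set.encard_le_encard Set.inter_subset_left).trans ?_
  rw [Set.encard_singleton]
  exact_mod_cast hm

/-- If the fibres of `v` are in `ED_fin[m]`, then long intervals contain many points whose values
avoid a given finite set. -/
theorem exists_finset_interval {α : Type*} [DecidableEq α] {m : ℕ} (v : ℕ → α) (F : Finset α)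
    (hv : ∀ a ∈ F, {x | v x = a} ∈ EDfinLe m) (K N : ℕ) :
    ∃ n ≥ N, ∃ E ⊆ intervalFinset n, E.card = K ∧ ∀ x ∈ E, v x ∉ F := by
  have h1 : ∀ᶠ n in Filter.atTop, ∀ a ∈ F, ({x | v x = a} ∩ interval n).encard ≤ m :=
    (Filter.eventually_all_finset F).2 fun a ha => mem_EDfinLe.1 (hv a ha)
  -- At most `m * F.card` of the `n` points of `I_n` have values in `F`, which leaves at least `K`.
  obtain ⟨n, h1, hn⟩ := (h1.and (Filter.eventually_ge_atTop (N + (m * F.card + K)))).exists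
  refine ⟨n, by omega, ?_⟩
  have hbad : ((intervalFinset n).filter fun x => v x ∈ F).card ≤ m * F.card := by
    refine Finset.card_le_mul_card_image_of_maps_to (f := v)
      (fun x hx => (Finset.mem_filter.1 hx).2) m fun a ha => ?_
    have h2 := h1 a ha
    rw [← Nat.cast_le (α := ℕ∞), ← Set.encard_coe_eq_coe_finsetCard]
    refine (Set.encard_le_encard fun x hx => ?_).trans h2
    simp only [Finset.coe_filter, Finset.mem_filter, Set.mem_ofPred_eq] at hx
    exact ⟨hx.2, coe_intervalFinset n ▸ hx.1.1⟩
  have hsum := Finset.card_filter_add_card_filter_not (s := intervalFinset n) fun x => v x ∈ F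
  rw [card_intervalFinset] at hsum
  obtain ⟨E, hE, hEK⟩ := Finset.exists_subset_card_eq
    (s := (intervalFinset n).filter fun x => ¬ v x ∈ F) (n := K) (by omega)
  exact ⟨E, hE.trans (Finset.filter_subset _ _), hEK, fun x hx => (Finset.mem_filter.1 (hE hx)).2⟩

/-- A version of `exists_finset_interval` for labelled partitions with one exceptional piece. -/
theorem exists_labels {m : ℕ} {v : ℕ → Option ℕ} (M : ℕ)
    (hv : ∀ o, o = none ∨ (∃ a < M, o = some a) → {x | v x = o} ∈ EDfinLe m) (K N : ℕ) :
    ∃ D : Finset ℕ, (D.card ≤ K ∧ ∃ n ≥ N, ∃ E ⊆ intervalFinset n, E.card = K ∧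
      ∀ x ∈ E, ∃ c ∈ D, v x = some c) ∧ ∀ y ∈ D, M ≤ y := by
  obtain ⟨n, hn, E, hE, hK, hEv⟩ := exists_finset_interval v
    (insert none ((Finset.range M).image some)) (m := m) (fun a ha => hv a (by
      simpa [eq_comm] using ha)) K N
  have hsome : ∀ x ∈ E, ∃ c, M ≤ c ∧ v x = some c := by
    intro x hx
    have h := hEv x hx
    cases hvx : v x with
    | none => simp [hvx] at h
    | some c => exact ⟨c, by simpa [hvx] using h, rfl⟩
  refine ⟨E.image fun x => (v x).getD 0, ⟨Finset.card_image_le.trans hK.le, n, hn, E, hE, hK,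
    fun x hx => ?_⟩, fun y hy => ?_⟩
  · obtain ⟨c, -, hc⟩ := hsome x hx
    exact ⟨c, Finset.mem_image.2 ⟨x, hx, by simp [hc]⟩, hc⟩
  · obtain ⟨x, hx, rfl⟩ := Finset.mem_image.1 hy
    obtain ⟨c, hMc, hc⟩ := hsome x hx
    simpa [hc] using hMc

theorem notMem_EDfinLe_of_frequently {m : ℕ} {A : Set ℕ}
    (h : ∀ N, ∃ n ≥ N, ∃ E ⊆ intervalFinset n, m < E.card ∧ (E : Set ℕ) ⊆ A) :
    A ∉ EDfinLe m := by
  rw [mem_EDfinLe]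
  intro hA
  obtain ⟨N, hN⟩ := Filter.eventually_atTop.1 hA
  obtain ⟨n, hn, E, hE, hm, hEA⟩ := h N
  have hsub : (E : Set ℕ) ⊆ A ∩ interval n := fun x hx =>
    ⟨hEA hx, coe_intervalFinset n ▸ hE hx⟩
  have h1 : (E : Set ℕ).encard ≤ m := (Set.encard_le_encard hsub).trans (hN n hn)
  rw [Set.encard_coe_eq_coe_finsetCard, Nat.cast_le] at h1
  omega

/-- Finite sets chosen one after the other, in disjoint blocks of intervals. -/
theorem exists_seq_blocks {P : ℕ → Finset ℕ → Prop}
    (h : ∀ s M, ∃ D : Finset ℕ, P s D ∧ ∀ y ∈ D, M ≤ y) :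
    ∃ D : ℕ → Finset ℕ, ∃ N : ℕ → ℕ, Monotone N ∧
      ∀ s, P s (D s) ∧ ∀ y ∈ D s, start (N s) ≤ y ∧ y < start (N (s + 1)) := by
  choose D hP hDM using h
  -- The `+ 2` puts `start (N (s + 1))` strictly above every element of the block, by
  -- `le_start_succ`.
  let N : ℕ → ℕ := fun s => Nat.rec 0 (fun s k => k + (D s (start k)).sup id + 2) s
  have hN : ∀ s, N (s + 1) = N s + (D s (start (N s))).sup id + 2 := fun _ => rfl
  refine ⟨fun s => D s (start (N s)), N, monotone_nat_of_le_succ fun s => by rw [hN]; omega,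
    fun s => ?_⟩
  refine ⟨hP _ _, fun y hy => ⟨hDM _ _ y hy, ?_⟩⟩
  have h1 : y ≤ (D s (start (N s))).sup id := Finset.le_sup (f := id) hy
  have h2 := le_start_succ (N s + (D s (start (N s))).sup id + 1)
  rw [hN]
  exact lt_of_lt_of_le (by omega) h2

theorem diagonalizes_EDfinLe (m : ℕ) : Diagonalizes (EDfinLe (m + 1)) (EDfinLe m) := by
  intro v hv
  -- Stage `s = ⟨i, k⟩` serves partition `i` beyond interval `k`, so each partition is served
  -- infinitely often.
  obtain ⟨D, N, hN, hD⟩ := exists_seq_blocks fun s M =>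
    exists_labels M (fun o _ => hv s.unpair.1 o) (m + 1) s.unpair.2
  refine ⟨⋃ s, (D s : Set ℕ), ?_, fun i => ?_⟩
  · rw [mem_EDfinLe]
    refine Filter.Eventually.of_forall fun k => ?_
    -- Hence a single interval meets at most one block `D s`.
    have hs : ∀ s, ∀ y ∈ D s, y ∈ interval k → N s ≤ k ∧ k < N (s + 1) := by
      intro s y hy hyk
      obtain ⟨h1, h2⟩ := (hD s).2 y hy
      rw [mem_interval] at hyk
      exact ⟨Nat.lt_succ_iff.1 (start_mono.reflect_lt (h1.trans_lt hyk.2)),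
        start_mono.reflect_lt (hyk.1.trans_lt h2)⟩
    by_cases hne : ∃ s, ∃ y ∈ D s, y ∈ interval k
    · obtain ⟨s, y, hy, hyk⟩ := hne
      have hsub : (⋃ s, (D s : Set ℕ)) ∩ interval k ⊆ D s := by
        rintro z ⟨hz, hzk⟩
        obtain ⟨t, hzt⟩ := Set.mem_iUnion.1 hz
        have h1 := hs s y hy hyk
        have h2 := hs t z hzt hzk
        rcases lt_trichotomy s t with hst | rfl | hst
        · have := hN (show s + 1 ≤ t from hst)
          omega
        · exact hzt
        · have := hN (show t + 1 ≤ s from hst)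
          omega
      refine (Set.encard_le_encard hsub).trans ?_
      rw [Set.encard_coe_eq_coe_finsetCard]
      exact_mod_cast (hD s).1.1
    · rw [Set.eq_empty_of_forall_notMem (s := (⋃ s, (D s : Set ℕ)) ∩ interval k)]
      · simp
      · rintro z ⟨hz, hzk⟩
        obtain ⟨t, hzt⟩ := Set.mem_iUnion.1 hz
        exact hne ⟨t, z, hzt, hzk⟩
  · refine notMem_EDfinLe_of_frequently fun k => ?_
    obtain ⟨n, hn, E, hE, hK, hEv⟩ := (hD (Nat.pair i k)).1.2
    rw [Nat.unpair_pair] at hn hEv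
    refine ⟨n, hn, E, hE, by omega, fun x hx => ?_⟩
    obtain ⟨c, hc, hxc⟩ := hEv x hx
    exact ⟨c, Set.mem_iUnion.2 ⟨_, hc⟩, hxc⟩

/-! ### The summable ideal -/

theorem sum_biUnion_le {f : ℕ → ℝ} (hf : ∀ n, 0 ≤ f n) (u : Finset ℕ) (D : ℕ → Finset ℕ) :
    ∑ y ∈ u.biUnion D, f y ≤ ∑ s ∈ u, ∑ y ∈ D s, f y := by
  induction u using Finset.induction_on with
  | empty => simp
  | insert a u ha ih =>
    rw [Finset.biUnion_insert, Finset.sum_insert ha]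
    have h1 := Finset.sum_union_inter (s₁ := D a) (s₂ := u.biUnion D) (f := f)
    have h2 : 0 ≤ ∑ y ∈ D a ∩ u.biUnion D, f y := Finset.sum_nonneg fun y _ => hf y
    linarith

/-- Countable subadditivity of the weight; the blocks may overlap. -/
theorem mem_SumIdeal_of_subset_iUnion {f : ℕ → ℝ} (hf : ∀ n, 0 ≤ f n) {A : Set ℕ}
    {D : ℕ → Finset ℕ} (hA : A ⊆ ⋃ s, (D s : Set ℕ))
    (hD : Summable fun s => ∑ y ∈ D s, f y) : A ∈ SumIdeal f := by
  classical
  refine summable_of_sum_le (c := ∑' s, ∑ y ∈ D s, f y) (fun x => hf x) fun u => ?_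
  choose t ht using fun x : A => Set.mem_iUnion.1 (hA x.2)
  calc ∑ x ∈ u, f x = ∑ y ∈ u.map (Function.Embedding.subtype _), f y := by simp
    _ ≤ ∑ y ∈ (u.image t).biUnion D, f y := by
        refine Finset.sum_le_sum_of_subset_of_nonneg (fun y hy => ?_) fun _ _ _ => hf _
        obtain ⟨x, hx, rfl⟩ := Finset.mem_map.1 hy
        exact Finset.mem_biUnion.2 ⟨t x, Finset.mem_image_of_mem t hx, ht x⟩
    _ ≤ ∑ s ∈ u.image t, ∑ y ∈ D s, f y := sum_biUnion_le hf _ _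
    _ ≤ ∑' s, ∑ y ∈ D s, f y :=
        hD.sum_le_tsum _ fun s _ => Finset.sum_nonneg fun y _ => hf y

theorem invFun_nonneg (n : ℕ) : (0 : ℝ) ≤ if n = 0 then 0 else 1 / (n : ℝ) := by
  split_ifs <;> positivity

theorem invFun_le {n M : ℕ} (hM : 0 < M) (h : M ≤ n) :
    (if n = 0 then 0 else 1 / (n : ℝ)) ≤ 1 / (M : ℝ) := by
  rw [if_neg (by omega)]
  exact one_div_le_one_div_of_le (by exact_mod_cast hM) (by exact_mod_cast h)

theorem singleton_mem_SumInv (v : ℕ) : {v} ∈ SumInv :=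
  by
  have := (Set.finite_singleton v).summable fun n : ℕ => if n = 0 then 0 else 1 / (n : ℝ)
  exact this

theorem diagonalizes_SumInv : Diagonalizes SumInv EDfin := by
  intro v hv
  -- The pieces of a partition need not share one `m`, but only finitely many labels are avoided at
  -- each stage.
  have hm : ∀ i M, ∃ m, ∀ o, o = none ∨ (∃ a < M, o = some a) →
      {x | v i x = o} ∈ EDfinLe m := by
    intro i M
    choose m hm using fun o => Set.mem_iUnion.1 (hv i o)
    refine ⟨(insert none ((Finset.range M).image some)).sup m, fun o ho => ?_⟩
    exact EDfinLe_mono (Finset.le_sup (f := m) (by simpa [eq_comm] using ho)) (hm o)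
  choose m hm using hm
  -- At stage `s = ⟨i, k⟩` at most `k` labels, each at least `(k + 1) * 2 ^ s`, weigh at most `2 ^
  -- (-s)`.
  choose D hD hDM using fun s : ℕ => exists_labels ((s.unpair.2 + 1) * 2 ^ s)
    (hm s.unpair.1 _) s.unpair.2 s.unpair.2
  refine ⟨⋃ s, (D s : Set ℕ), ?_, fun i => ?_⟩
  · refine mem_SumIdeal_of_subset_iUnion invFun_nonneg subset_rfl ?_
    refine Summable.of_nonneg_of_le (fun s => Finset.sum_nonneg fun y _ => invFun_nonneg y)
      (fun s => ?_) summable_geometric_two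
    refine (Finset.sum_le_card_nsmul _ _ _ fun y hy =>
      invFun_le (by positivity) (hDM s y hy)).trans ?_
    have h1 : ((D s).card : ℝ) ≤ s.unpair.2 + 1 := by
      exact_mod_cast (hD s).1.trans (Nat.le_succ _)
    rw [nsmul_eq_mul]
    push_cast
    rw [mul_one_div, div_le_iff₀ (by positivity)]
    calc ((D s).card : ℝ) ≤ s.unpair.2 + 1 := h1
      _ = (1 / 2) ^ s * ((s.unpair.2 + 1) * 2 ^ s) := by
        rw [one_div, inv_pow]
        field_simp
  · intro h
    obtain ⟨k, hk⟩ := Set.mem_iUnion.1 h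
    refine notMem_EDfinLe_of_frequently (fun N => ?_) hk
    -- The maximum gives both an interval past `N` and more than `k` points in it.
    obtain ⟨n, hn, E, hE, hK, hEv⟩ := (hD (Nat.pair i (max N (k + 1)))).2
    rw [Nat.unpair_pair] at hn hEv hK
    refine ⟨n, by omega, E, hE, by omega, fun x hx => ?_⟩
    obtain ⟨c, hc, hxc⟩ := hEv x hx
    exact ⟨c, Set.mem_iUnion.2 ⟨_, hc⟩, hxc⟩

theorem sq_le_start {n : ℕ} (hn : 2 ≤ n) : n ^ 2 ≤ 4 * start n := by
  induction n, hn using Nat.le_induction with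
  | base => decide
  | succ n hn ih =>
    rw [start_succ]
    nlinarith

theorem EDfin_subset_SumInv : EDfin ⊆ SumInv := by
  classical
  intro A hA
  obtain ⟨m, hm⟩ := Set.mem_iUnion.1 hA
  rw [mem_EDfinLe] at hm
  refine mem_SumIdeal_of_subset_iUnion (D := fun n => (intervalFinset n).filter (· ∈ A))
    invFun_nonneg (fun x hx => ?_) ?_
  · obtain ⟨n, hn⟩ := exists_mem_interval x
    rw [← coe_intervalFinset] at hn
    exact Set.mem_iUnion.2 ⟨n, Finset.mem_coe.2 (Finset.mem_filter.2 ⟨hn, hx⟩)⟩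
  · refine Summable.of_norm_bounded_eventually_nat (g := fun n => (4 * m : ℝ) * (1 / (n : ℝ) ^ 2))
      ((Real.summable_one_div_nat_pow.2 one_lt_two).mul_left _) ?_
    filter_upwards [hm, Filter.eventually_ge_atTop 2] with n hn h2
    rw [Real.norm_of_nonneg (Finset.sum_nonneg fun y _ => invFun_nonneg y)]
    have hsq := sq_le_start h2
    have hpos : 0 < start n := by
      have : 0 < n ^ 2 := by positivity
      omega
    refine (Finset.sum_le_card_nsmul _ _ _ fun y hy =>
      invFun_le hpos (Finset.mem_Ico.1 (Finset.mem_filter.1 hy).1).1).trans ?_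
    have hcard : ((intervalFinset n).filter (· ∈ A)).card ≤ m := by
      rw [← Nat.cast_le (α := ℕ∞), ← Set.encard_coe_eq_coe_finsetCard]
      refine (Set.encard_le_encard fun x hx => ?_).trans hn
      have hx := Finset.mem_filter.1 (Finset.mem_coe.1 hx)
      exact ⟨hx.2, coe_intervalFinset n ▸ hx.1⟩
    have hcard' : (((intervalFinset n).filter (· ∈ A)).card : ℝ) ≤ m := by exact_mod_cast hcard
    have hsq' : (n : ℝ) ^ 2 ≤ 4 * start n := by exact_mod_cast hsq
    have hpos' : (0 : ℝ) < start n := by exact_mod_cast hpos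
    rw [nsmul_eq_mul, mul_one_div, mul_one_div,
      div_le_div_iff₀ hpos' (by positivity)]
    calc _ ≤ (m : ℝ) * (4 * start n) := mul_le_mul hcard' hsq' (by positivity) (by positivity)
      _ = _ := by ring

/-! ### The chain -/

theorem not_EDfinLe_succ_le (m : ℕ) :
    ¬ lowerTopology (EDfinLe (m + 1)) ≤ lowerTopology (EDfinLe m) :=
  (diagonalizes_EDfinLe m).not_le (isLowerSet_EDfinLe m) (singleton_mem_EDfinLe (by omega))

theorem lowerTopology_EDfinLe_strictMono : StrictMono fun m => lowerTopology (EDfinLe m) :=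
  strictMono_nat_of_lt_succ fun m =>
    ⟨lowerTopology_mono (EDfinLe_mono m.le_succ), not_EDfinLe_succ_le m⟩

theorem EDfinLe_lt_EDfin (m : ℕ) : lowerTopology (EDfinLe m) < lowerTopology EDfin :=
  (lowerTopology_EDfinLe_strictMono m.lt_succ_self).trans_le
    (lowerTopology_mono (Set.subset_iUnion EDfinLe (m + 1)))

end EffTop

theorem mainTheorem3 :
    EffTop.lowerTopology EffTop.FinIdeal < EffTop.lowerTopology (EffTop.EDfinLe 1) ∧
    (∀ m : ℕ, 1 ≤ m →
      EffTop.lowerTopology (EffTop.EDfinLe m) < EffTop.lowerTopology (EffTop.EDfinLe (m + 1))) ∧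
    (∀ m : ℕ, 1 ≤ m →
      EffTop.lowerTopology (EffTop.EDfinLe m) < EffTop.lowerTopology EffTop.EDfin) ∧
    EffTop.lowerTopology EffTop.EDfin < EffTop.lowerTopology EffTop.SumInv ∧
    (∀ m n : ℕ, 1 ≤ m → 1 ≤ n →
      EffTop.lowerTopology (EffTop.EDfinLe m) ≤ EffTop.lowerTopology (EffTop.EDfinLe n) →
      EffTop.lowerTopology (EffTop.EDfinLe n) ≤ EffTop.lowerTopology (EffTop.EDfinLe m) →
      m = n) := by
  refine ⟨?_, fun m _ => EffTop.lowerTopology_EDfinLe_strictMono m.lt_succ_self,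
    fun m _ => EffTop.EDfinLe_lt_EDfin m,
    ⟨EffTop.lowerTopology_mono EffTop.EDfin_subset_SumInv,
      EffTop.diagonalizes_SumInv.not_le EffTop.isLowerSet_EDfin EffTop.singleton_mem_SumInv⟩,
    fun m n _ _ hmn hnm => ?_⟩
  · rw [← EffTop.EDfinLe_zero]
    exact EffTop.lowerTopology_EDfinLe_strictMono Nat.zero_lt_one
  · rcases lt_trichotomy m n with h | h | h
    · exact ((EffTop.lowerTopology_EDfinLe_strictMono h).not_ge hnm).elim
    · exact h
    · exact ((EffTop.lowerTopology_EDfinLe_strictMono h).not_ge hmn).elim
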